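/- Let $0<p<1$ and let $\mu$ be the $p$-biased product measure on $\{-1,1\}^n$: the coordinates are independent, each equal to $1$ with probability $p$ and to $-1$ with probability $1-p$. Variances and norms are taken with respect to $\mu$ (so $\|g\|_q^q=\int|g|^q\,d\mu$), and $\mathbb{E}_i g$ denotes the integral of $g$ over the $i$-th coordinate only. For each $n\ge 1$ let $f_n:\{-1,1\}^n\to\mathbb{R}$, and put $f_n^{(i)}=f_n-\mathbb{E}_i f_n$ for $1\le i\le n$. Suppose that $\mathrm{var}(f_n)>0$ for all $n\ge 1$ and that $\mathrm{var}(f_n)=o(n^{\varepsilon})$ as $n\to\infty$ for every $\varepsilon>0$. Then $$\liminf_{n\to\infty}\frac{\max_{1\le i\le n}\|f_n^{(i)}\|_1}{\mathrm{var}(f_n)\,\frac{\ln n}{n}}\ \ge\ \frac{C_0}{M_0},$$ where $$M_0=\limsup_{n\to\infty}\ \max_{i:\,f_n^{(i)}\ne 0}\frac{\|f_n^{(i)}\|_2^2}{\|f_n^{(i)}\|_1}\in[0,\infty],\qquad C_0=\sup_{\alpha>0}\frac{\tanh(\alpha/2)}{\alpha-\ln\left(\rho_2(\alpha)^2\right)},\qquad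 \rho_2(\alpha)=\rho(e^{\alpha}+1),$$ and, with $\lambda=\min\{p,1-p\}$, the function $\rho$ is any one of the following three: (i) $\rho(q)=\lambda^{\frac12-\frac1q}$; (ii) $\rho(q)=\sqrt{q-1}\,\sqrt{\dfrac{\sinh\left(-\frac1q\ln\frac{\lambda}{1-\lambda}\right)}{\sinh\left(-\left(1-\frac1q\right)\ln\frac{\lambda}{1-\lambda}\right)}}$, which for $p=\frac12$ is read as its limiting value $1$; (iii) $\rho(q)=\sqrt{\dfrac{\lambda}{1-\lambda}}$. Here $C_0>0$, and $C_0/M_0$ is interpreted as $\infty$ if $M_0=0$ and as $0$ if $M_0=\infty$. -/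

import Mathlib

open Filter Asymptotics
open scoped Topology ENNReal

namespace BiasedCube

noncomputable section

/-- The discrete cube `{-1, 1}^n`; the two units of `ℤ` are exactly `1` and `-1`. -/
abbrev Cube (n : ℕ) : Type := Fin n → ℤˣ

/-- The `p`-biased weight of one coordinate: `1` has weight `p`, and `-1` has weight `1 - p`. -/
def coordWeight (p : ℝ) (s : ℤˣ) : ℝ := if s = 1 then p else 1 - p

/-- The mass of the point `x` under the `p`-biased product measure on `{-1, 1}^n`. -/
def mass (p : ℝ) {n : ℕ} (x : Cube n) : ℝ := ∏ i, coordWeight p (x i)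

/-- Expectation under the `p`-biased measure. -/
def expect (p : ℝ) {n : ℕ} (f : Cube n → ℝ) : ℝ := ∑ x, f x * mass p x

/-- Variance under the `p`-biased measure. -/
def variance (p : ℝ) {n : ℕ} (f : Cube n → ℝ) : ℝ :=
  expect p fun x => (f x - expect p f) ^ 2

/-- The norm of `L^q` of the `p`-biased measure, for finite `q`. -/
def lqNorm (p : ℝ) {n : ℕ} (q : ℝ) (f : Cube n → ℝ) : ℝ :=
  (expect p fun x => |f x| ^ q) ^ (1 / q)

/-- `E_i f`: integration of `f` over the `i`-th coordinate only. -/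
def coordExpect (p : ℝ) {n : ℕ} (i : Fin n) (f : Cube n → ℝ) : Cube n → ℝ :=
  fun x => p * f (Function.update x i 1) + (1 - p) * f (Function.update x i (-1))

/-- `f^{(i)} = f - E_i f`. -/
def coordDiff (p : ℝ) {n : ℕ} (i : Fin n) (f : Cube n → ℝ) : Cube n → ℝ :=
  f - coordExpect p i f

/-- `λ = min {p, 1 - p}`. -/
def minProb (p : ℝ) : ℝ := min p (1 - p)

/-- First smoothing parameter: `λ ^ (1/2 - 1/q)`. -/
def rhoPower (p q : ℝ) : ℝ := minProb p ^ (1 / 2 - 1 / q)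

/-- Second (optimal) smoothing parameter. For `p = 1/2` the quotient of the two hyperbolic sines
is `0 / 0`, and the parameter is the limit `1` as `λ → 1/2`. -/
def rhoSinh (p q : ℝ) : ℝ :=
  if p = 1 / 2 then 1
  else
    √(q - 1) *
      √(Real.sinh (-(1 / q) * Real.log (minProb p / (1 - minProb p))) /
        Real.sinh (-(1 - 1 / q) * Real.log (minProb p / (1 - minProb p))))

/-- Third smoothing parameter: `√(λ / (1 - λ))`, independent of `q`. -/
def rhoConst (p _q : ℝ) : ℝ := √(minProb p / (1 - minProb p))

/-- `C₀ = sup_{α > 0} tanh (α / 2) / (α - ln ρ₂(α)²)`, where `ρ₂(α) = ρ (e^α + 1)`.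
For the three smoothing parameters the numerator and the denominator are positive, so that
`ENNReal.ofReal` loses nothing. -/
def constC (ρ : ℝ → ℝ) : ℝ≥0∞ :=
  ⨆ (α : ℝ) (_ : 0 < α),
    ENNReal.ofReal (Real.tanh (α / 2) / (α - Real.log (ρ (Real.exp α + 1) ^ 2)))

/-- `M₀ = limsup_n max_{i : f_n^{(i)} ≠ 0} ‖f_n^{(i)}‖₂² / ‖f_n^{(i)}‖₁`, with values
in `[0, ∞]`. -/
def constM (p : ℝ) (f : (n : ℕ) → Cube n → ℝ) : ℝ≥0∞ :=
  limsup
    (fun n : ℕ => ⨆ (i : Fin n) (_ : coordDiff p i (f n) ≠ 0),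
      ENNReal.ofReal
        (lqNorm p 2 (coordDiff p i (f n)) ^ 2 / lqNorm p 1 (coordDiff p i (f n))))
    atTop

end

end BiasedCube

namespace BiasedCube

/-! The theorem follows from a Talagrand-type inequality with explicit constants. In the orthonormal
Fourier basis of the biased cube, let `noiseEnergy p R g` be the squared L²-norm of `g` after
damping level `|S|` by `R ^ (|S| / 2)`. The sum of the energies of all `f^{(i)}`, with `R = e^{-D}`,
is estimated in two ways.

From below (`variance_mul_exp_le`): it equals `∑ |S| e^{-D|S|} \hat f(S)²`. Since the total
L²-influence divided by the variance is the average of `|S|` under the spectral distribution of `f`,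
convexity gives at least `V e^{-Dx}` whenever that average is at most `x`.

From above (`noiseEnergy_le`, `noiseEnergy_le_interpolate`): biased hypercontractivity bounds each
energy by a squared L^s-norm, and Hölder bounds that by L¹- and L²-norms with exponent `t = (2 - s)
/ s`. The rate comes from a sharp two-point inequality (`two_point`) and tensorizes by induction on
`n`.

If all L¹-influences are at most `δ = c V ln n / n` and `‖f^{(i)}‖₂² ≤ M ‖f^{(i)}‖₁`, the lower
bound is `V n^{-DcM}`, while the upper bound is `V n^{-t}` up to constants, powers of `ln n` and
`V^t`. As `V` is subpolynomial, `DcM < t` is impossible for large `n`. Taking `s = 1 + e^{-α}` makes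
`t = tanh (α / 2)`, and `D = α - ln ρ₂(α)²` is admissible for all three choices of `ρ`
(`smoothing_sq_le_optimalRate`). -/

/-! ### Inequalities for hyperbolic functions. -/

lemma sinh_mul_le {θ x : ℝ} (hθ0 : 0 ≤ θ) (hθ1 : θ ≤ 1) (hx : 0 ≤ x) :
    Real.sinh (θ * x) ≤ θ * Real.sinh x := by
  have hd : ∀ y : ℝ, HasDerivAt (fun y => θ * Real.sinh y - Real.sinh (θ * y))
      (θ * Real.cosh y - Real.cosh (θ * y) * θ) y := fun y => by
    have h := (Real.hasDerivAt_sinh y).const_mul θ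
    have h2 := ((hasDerivAt_id y).const_mul θ).sinh
    simpa using h.fun_sub h2
  have hm : MonotoneOn (fun y => θ * Real.sinh y - Real.sinh (θ * y)) (Set.Ici 0) := by
    refine monotoneOn_of_deriv_nonneg (convex_Ici 0)
      (fun y _ => (hd y).continuousAt.continuousWithinAt)
      (fun y _ => (hd y).differentiableAt.differentiableWithinAt) fun y hy => ?_
    rw [interior_Ici, Set.mem_Ioi] at hy
    rw [(hd y).deriv]
    have : Real.cosh (θ * y) ≤ Real.cosh y := by
      rw [Real.cosh_le_cosh, abs_of_nonneg hy.le, abs_of_nonneg (by positivity)]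
      nlinarith
    nlinarith
  have := hm (Set.self_mem_Ici) hx hx
  simp only [mul_zero, Real.sinh_zero, sub_zero] at this
  linarith

/-- The function `sinh x * e^{-x} = (1 - e^{-2x}) / 2` is concave and vanishes at `0`, so its
quotient by `x` decreases. -/
lemma mul_sinh_mul_exp_neg_le {a b : ℝ} (ha : 0 < a) (hab : a ≤ b) :
    a * (Real.sinh b * Real.exp (-b)) ≤ b * (Real.sinh a * Real.exp (-a)) := by
  have hb : 0 < b := ha.trans_le hab
  have key : ∀ x : ℝ, Real.sinh x * Real.exp (-x) = (1 - Real.exp (-2 * x)) / 2 := fun x => by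
    have h1 : Real.exp x * Real.exp (-x) = 1 := by rw [← Real.exp_add]; simp
    have h2 : Real.exp (-2 * x) = Real.exp (-x) * Real.exp (-x) := by
      rw [← Real.exp_add]; congr 1; ring
    rw [Real.sinh_eq, h2]
    linear_combination h1 / 2
  have hc := convexOn_exp.2 (Set.mem_univ 0) (Set.mem_univ (-2 * b))
    (show 0 ≤ 1 - a / b by rw [sub_nonneg, div_le_one hb]; exact hab)
    (show 0 ≤ a / b by positivity) (by ring)
  simp only [smul_eq_mul, mul_zero, zero_add, Real.exp_zero, mul_one] at hc
  rw [show a / b * (-2 * b) = -2 * a by field_simp] at hc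
  rw [key, key]
  have h3 : b * (1 - a / b + a / b * Real.exp (-2 * b)) = b - a + a * Real.exp (-2 * b) := by
    field_simp
  have h4 := mul_le_mul_of_nonneg_left hc hb.le
  rw [h3] at h4
  linarith

/-- Lower bound for a ratio of hyperbolic sines. -/
lemma mul_exp_le_sinh_div_sinh {a b : ℝ} (ha : 0 < a) (hab : a ≤ b) :
    a / b * Real.exp (-(b - a)) ≤ Real.sinh a / Real.sinh b := by
  have hb : 0 < b := ha.trans_le hab
  have hs : 0 < Real.sinh b := Real.sinh_pos_iff.2 hb
  have h := mul_sinh_mul_exp_neg_le ha hab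
  rw [le_div_iff₀ hs, show -(b - a) = a + -b by ring, Real.exp_add]
  have h1 : Real.exp a * Real.exp (-a) = 1 := by rw [← Real.exp_add]; simp
  have h2 := mul_le_mul_of_nonneg_right h (Real.exp_pos a).le
  have h3 : a / b * (Real.exp a * Real.exp (-b)) * Real.sinh b
      = a * (Real.sinh b * Real.exp (-b)) * Real.exp a / b := by ring
  rw [h3, div_le_iff₀ hb]
  calc _ ≤ _ := h2
    _ = Real.sinh a * b * (Real.exp a * Real.exp (-a)) := by ring
    _ = _ := by rw [h1, mul_one]

lemma hasDerivAt_two_mul_cosh_rpow (s e v : ℝ) :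
    HasDerivAt (fun v => (2 * Real.cosh (s * v)) ^ e)
      (2 * (s * Real.sinh (s * v)) * e * (2 * Real.cosh (s * v)) ^ (e - 1)) v := by
  have h : HasDerivAt (fun v => 2 * Real.cosh (s * v)) (2 * (s * Real.sinh (s * v))) v := by
    have := (((hasDerivAt_id v).const_mul s).cosh).const_mul 2
    simpa [mul_comm, mul_left_comm] using this
  exact h.rpow_const (Or.inl (by positivity))

/-- Up to a factor `2`, this is the derivative of `(2 cosh (s v)) ^ (2 / s)` with respect to `cosh
(2 v)`; its monotonicity is convexity in that variable. The numerator of its derivative in `v`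
collapses to a positive multiple of `(s - 1) sinh (2v) - sinh ((s - 1) 2v)`, which `sinh_mul_le`
makes nonnegative. -/
lemma monotoneOn_cosh_rpow_slope {s : ℝ} (hs1 : 1 < s) (hs2 : s < 2) :
    MonotoneOn (fun v => (2 * Real.cosh (s * v)) ^ (2 / s - 1) * Real.sinh (s * v) /
      Real.sinh (2 * v)) (Set.Ioi 0) := by
  have hsp : ∀ v : ℝ, 0 < v → 0 < Real.sinh (2 * v) := fun v hv =>
    Real.sinh_pos_iff.2 (by positivity)
  have hd : ∀ v : ℝ, 0 < v → HasDerivAt (fun v => (2 * Real.cosh (s * v)) ^ (2 / s - 1) *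
      Real.sinh (s * v) / Real.sinh (2 * v))
      (((2 * (s * Real.sinh (s * v)) * (2 / s - 1) * (2 * Real.cosh (s * v)) ^ (2 / s - 1 - 1) *
        Real.sinh (s * v) + (2 * Real.cosh (s * v)) ^ (2 / s - 1) * (s * Real.cosh (s * v))) *
        Real.sinh (2 * v) - (2 * Real.cosh (s * v)) ^ (2 / s - 1) * Real.sinh (s * v) *
        (2 * Real.cosh (2 * v))) / Real.sinh (2 * v) ^ 2) v := fun v hv => by
    have h1 : HasDerivAt (fun v => Real.sinh (s * v)) (s * Real.cosh (s * v)) v := by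
      have := ((hasDerivAt_id v).const_mul s).sinh
      simpa [mul_comm] using this
    have h2 : HasDerivAt (fun v => Real.sinh (2 * v)) (2 * Real.cosh (2 * v)) v := by
      have := ((hasDerivAt_id v).const_mul 2).sinh
      simpa [mul_comm] using this
    exact ((hasDerivAt_two_mul_cosh_rpow s (2 / s - 1) v).mul h1).div h2 (hsp v hv).ne'
  refine monotoneOn_of_deriv_nonneg (convex_Ioi 0)
    (fun y hy => (hd y hy).continuousAt.continuousWithinAt)
    (fun y hy => (hd y (by simpa using hy)).differentiableAt.differentiableWithinAt)
    fun v hv => ?_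
  rw [interior_Ioi, Set.mem_Ioi] at hv
  rw [(hd v hv).deriv]
  refine div_nonneg ?_ (sq_nonneg _)
  have hC : 0 < 2 * Real.cosh (s * v) := by positivity
  have hpow : (2 * Real.cosh (s * v)) ^ (2 / s - 1)
      = (2 * Real.cosh (s * v)) ^ (2 / s - 1 - 1) * (2 * Real.cosh (s * v)) := by
    rw [← Real.rpow_add_one hC.ne']; congr 1; ring
  rw [hpow]
  have hse : s * (2 / s - 1) = 2 - s := by field_simp
  have hmain : Real.sinh ((s - 1) * (2 * v)) ≤ (s - 1) * Real.sinh (2 * v) :=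
    sinh_mul_le (by linarith) (by linarith) (by positivity)
  have hsub : Real.sinh ((s - 1) * (2 * v)) =
      2 * Real.sinh (s * v) * Real.cosh (s * v) * Real.cosh (2 * v) -
      (2 * Real.cosh (s * v) ^ 2 - 1) * Real.sinh (2 * v) := by
    rw [show (s - 1) * (2 * v) = 2 * (s * v) - 2 * v by ring, Real.sinh_sub,
      Real.sinh_two_mul (s * v), Real.cosh_two_mul (s * v), Real.sinh_sq (s * v)]
    ring
  have hsq := Real.cosh_sq (s * v)
  have hX : 0 < (2 * Real.cosh (s * v)) ^ (2 / s - 1 - 1) := by positivity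
  set X := (2 * Real.cosh (s * v)) ^ (2 / s - 1 - 1)
  have : (2 * (s * Real.sinh (s * v)) * (2 / s - 1) * X * Real.sinh (s * v) +
      X * (2 * Real.cosh (s * v)) * (s * Real.cosh (s * v))) * Real.sinh (2 * v) -
      X * (2 * Real.cosh (s * v)) * Real.sinh (s * v) * (2 * Real.cosh (2 * v))
      = 2 * X * ((s - 1) * Real.sinh (2 * v) - Real.sinh ((s - 1) * (2 * v))) := by
    rw [hsub]
    linear_combination 2 * X * Real.sinh (s * v) ^ 2 * Real.sinh (2 * v) * hse
      - 2 * X * Real.sinh (2 * v) * (2 - s) * hsq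
  rw [this]
  have := sub_nonneg.2 hmain
  positivity

/-- `(2 cosh (s v)) ^ (2 / s)` lies above its tangents as a function of `cosh (2 v)`. -/
lemma cosh_rpow_tangent_le {s v₀ v : ℝ} (hs1 : 1 < s) (hs2 : s < 2) (hv₀ : 0 < v₀) (hv : 0 ≤ v) :
    (2 * Real.cosh (s * v₀)) ^ (2 / s) + 2 * ((2 * Real.cosh (s * v₀)) ^ (2 / s - 1) *
      Real.sinh (s * v₀) / Real.sinh (2 * v₀)) * (Real.cosh (2 * v) - Real.cosh (2 * v₀))
      ≤ (2 * Real.cosh (s * v)) ^ (2 / s) := by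
  have hG := monotoneOn_cosh_rpow_slope hs1 hs2
  set G : ℝ → ℝ := fun v => (2 * Real.cosh (s * v)) ^ (2 / s - 1) * Real.sinh (s * v) /
      Real.sinh (2 * v) with hGdef
  change (2 * Real.cosh (s * v₀)) ^ (2 / s) + 2 * G v₀ * _ ≤ _
  set F : ℝ → ℝ := fun v => (2 * Real.cosh (s * v)) ^ (2 / s) - 2 * G v₀ * Real.cosh (2 * v)
  have hd : ∀ v, HasDerivAt F (2 * (s * Real.sinh (s * v)) * (2 / s) *
      (2 * Real.cosh (s * v)) ^ (2 / s - 1) - 2 * G v₀ * (2 * Real.sinh (2 * v))) v := fun v => by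
    have h2 : HasDerivAt (fun v => Real.cosh (2 * v)) (2 * Real.sinh (2 * v)) v := by
      have := ((hasDerivAt_id v).const_mul 2).cosh
      simpa [mul_comm] using this
    exact (hasDerivAt_two_mul_cosh_rpow s (2 / s) v).sub (h2.const_mul _)
  have hsp : ∀ v : ℝ, 0 < v → 0 < Real.sinh (2 * v) := fun v hv =>
    Real.sinh_pos_iff.2 (by positivity)
  -- The derivative of `F` has the sign of `G v - G v₀`, so `F` has its minimum over `v ≥ 0` at
  -- `v₀`.
  have hd' : ∀ v, 0 < v → deriv F v = 4 * Real.sinh (2 * v) * (G v - G v₀) := fun v hv => by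
    have := hsp v hv
    have h1 : G v * Real.sinh (2 * v)
        = (2 * Real.cosh (s * v)) ^ (2 / s - 1) * Real.sinh (s * v) :=
      div_mul_cancel₀ _ this.ne'
    have hse : s * (2 / s) = 2 := by field_simp
    rw [(hd v).deriv]
    linear_combination 2 * Real.sinh (s * v) * (2 * Real.cosh (s * v)) ^ (2 / s - 1) * hse - 4 * h1
  suffices F v₀ ≤ F v by
    simp only [F] at this
    linarith
  rcases le_total v v₀ with h | h
  · have hm : AntitoneOn F (Set.Icc 0 v₀) := by
      refine antitoneOn_of_deriv_nonpos (convex_Icc 0 v₀)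
        (fun y _ => (hd y).continuousAt.continuousWithinAt)
        (fun y _ => (hd y).differentiableAt.differentiableWithinAt) fun y hy => ?_
      rw [interior_Icc] at hy
      rw [hd' y hy.1]
      exact mul_nonpos_of_nonneg_of_nonpos (by have := hsp y hy.1; positivity)
        (sub_nonpos.2 (hG hy.1 hv₀ hy.2.le))
    exact hm ⟨hv, h⟩ ⟨hv₀.le, le_rfl⟩ h
  · have hm : MonotoneOn F (Set.Ici v₀) := by
      refine monotoneOn_of_deriv_nonneg (convex_Ici v₀)
        (fun y _ => (hd y).continuousAt.continuousWithinAt)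
        (fun y _ => (hd y).differentiableAt.differentiableWithinAt) fun y hy => ?_
      rw [interior_Ici, Set.mem_Ioi] at hy
      have hy0 := hv₀.trans hy
      rw [hd' y hy0]
      exact mul_nonneg (by have := hsp y hy0; positivity) (sub_nonneg.2 (hG hv₀ hy0 hy.le))
    exact hm Set.self_mem_Ici h h

/-- The two-point inequality in exponential coordinates, for `p < 1/2` and with the optimal rate.
After the shift `v = |w - u / (2s)|`, the left side is, up to a factor, a tangent of the convex
function in `cosh_rpow_tangent_le`. -/
lemma cosh_sq_add_le {s u : ℝ} (hs1 : 1 < s) (hs2 : s < 2) (hu : 0 < u) (w : ℝ) :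
    Real.cosh (w - u / 2) ^ 2 + Real.sinh (u - u / s) / Real.sinh (u / s) * Real.sinh w ^ 2
      ≤ Real.cosh (u / 2) ^ 2 * (Real.cosh (s * w - u / 2) / Real.cosh (u / 2)) ^ (2 / s) := by
  have hs0 : 0 < s := by linarith
  set U := u / s with hU
  have hU0 : 0 < U := by positivity
  have hsU : s * U = u := by rw [hU]; field_simp
  -- The point of tangency corresponds to `w = 0`, i.e. to equal values at the two points, where
  -- equality holds.
  have h := cosh_rpow_tangent_le (v₀ := U / 2) (v := |w - U / 2|) hs1 hs2 (by positivity)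
    (abs_nonneg _)
  have e1 : Real.cosh (2 * |w - U / 2|) = Real.cosh (2 * w - U) := by
    rw [← Real.cosh_abs (2 * w - U), show 2 * w - U = 2 * (w - U / 2) by ring, abs_mul]; simp
  have e2 : Real.cosh (s * |w - U / 2|) = Real.cosh (s * w - u / 2) := by
    rw [← Real.cosh_abs (s * w - u / 2), show s * w - u / 2 = s * (w - U / 2) by
      rw [← hsU]; ring, abs_mul, abs_of_pos hs0]
  rw [e1, e2, show s * (U / 2) = u / 2 by rw [← hsU]; ring, show 2 * (U / 2) = U by ring] at h
  set Z := 2 * Real.cosh (u / 2) with hZ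
  have hZ0 : 0 < Z := by positivity
  have hSU : 0 < Real.sinh U := Real.sinh_pos_iff.2 hU0
  have hZr : Z ^ (2 / s - 1) = Z ^ (2 / s) / Z := by rw [Real.rpow_sub_one hZ0.ne']
  have hP : 0 < Z ^ (2 / s) := by positivity
  have hquot : (Real.cosh (s * w - u / 2) / Real.cosh (u / 2)) ^ (2 / s)
      = (2 * Real.cosh (s * w - u / 2)) ^ (2 / s) / Z ^ (2 / s) := by
    rw [← Real.div_rpow (by positivity) hZ0.le]
    congr 1
    rw [hZ]; field_simp
  rw [hquot, ← mul_div_assoc, le_div_iff₀ hP]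
  refine le_trans (le_of_eq ?_) (mul_le_mul_of_nonneg_left h (by positivity))
  rw [hZr]
  have hcosh : Real.cosh (2 * w - U) - Real.cosh U = 2 * Real.sinh w * Real.sinh (w - U) := by
    have hgen : ∀ x y : ℝ, Real.cosh (x + y) - Real.cosh (x - y) = 2 * Real.sinh x * Real.sinh y :=
      fun x y => by rw [Real.cosh_add, Real.cosh_sub]; ring
    rw [← hgen]; ring_nf
  have hsq : Real.cosh (w - u / 2) ^ 2 - Real.cosh (u / 2) ^ 2
      = Real.sinh w * Real.sinh (w - u) := by
    have hgen : ∀ x y : ℝ, Real.cosh x ^ 2 - Real.cosh y ^ 2 = Real.sinh (x + y) * Real.sinh (x - y) :=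
      fun x y => by
        rw [Real.sinh_add, Real.sinh_sub]
        linear_combination (Real.cosh y ^ 2) * Real.cosh_sq x - Real.cosh x ^ 2 * Real.cosh_sq y
    rw [hgen]; ring_nf
  have hid : Real.sinh u * Real.sinh (w - U) =
      Real.sinh U * Real.sinh (w - u) + Real.sinh (u - U) * Real.sinh w := by
    rw [Real.sinh_sub, Real.sinh_sub, Real.sinh_sub]; ring
  have h2 : Real.sinh u = 2 * Real.sinh (u / 2) * Real.cosh (u / 2) := by
    rw [← Real.sinh_two_mul]; ring_nf
  rw [hcosh, hZ]
  rw [show Real.cosh (w - u / 2) ^ 2 = Real.cosh (u / 2) ^ 2 + Real.sinh w * Real.sinh (w - u) by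
    linarith]
  have hc : 0 < Real.cosh (u / 2) := by positivity
  rw [h2] at hid
  field_simp
  linear_combination (-Real.sinh w) * hid

/-- The limit `u → 0` of `cosh_sq_add_le`. The ratio of sines, which is `0 / 0` there, is first
replaced by a lower bound continuous at `0`. -/
lemma cosh_sq_add_le_of_zero {s : ℝ} (hs1 : 1 < s) (hs2 : s < 2) (w : ℝ) :
    Real.cosh w ^ 2 + (s - 1) * Real.sinh w ^ 2 ≤ Real.cosh (s * w) ^ (2 / s) := by
  have hs0 : 0 < s := by linarith
  have hle : ∀ u : ℝ, 0 < u → Real.cosh (w - u / 2) ^ 2 +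
      (s - 1) * Real.exp (u - 2 * (u / s)) * Real.sinh w ^ 2
      ≤ Real.cosh (u / 2) ^ 2 * (Real.cosh (s * w - u / 2) / Real.cosh (u / 2)) ^ (2 / s) := by
    intro u hu
    refine le_trans ?_ (cosh_sq_add_le hs1 hs2 hu w)
    have h1 : 0 < u - u / s := by
      rw [sub_pos, div_lt_iff₀ hs0]; nlinarith
    have h2 : u - u / s ≤ u / s := by
      rw [sub_le_iff_le_add, ← add_div, le_div_iff₀ hs0]; nlinarith
    have h := mul_exp_le_sinh_div_sinh h1 h2
    have h3 : (u - u / s) / (u / s) = s - 1 := by field_simp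
    rw [h3, show -(u / s - (u - u / s)) = u - 2 * (u / s) by ring] at h
    gcongr
  have hl : Tendsto (fun u : ℝ => Real.cosh (w - u / 2) ^ 2 +
      (s - 1) * Real.exp (u - 2 * (u / s)) * Real.sinh w ^ 2) (𝓝[>] 0)
      (𝓝 (Real.cosh w ^ 2 + (s - 1) * Real.sinh w ^ 2)) := by
    have hc : Continuous fun u : ℝ => Real.cosh (w - u / 2) ^ 2 +
      (s - 1) * Real.exp (u - 2 * (u / s)) * Real.sinh w ^ 2 := by fun_prop
    have := (hc.tendsto 0).mono_left (nhdsWithin_le_nhds (s := Set.Ioi 0))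
    simpa using this
  have hr : Tendsto (fun u : ℝ => Real.cosh (u / 2) ^ 2 *
      (Real.cosh (s * w - u / 2) / Real.cosh (u / 2)) ^ (2 / s)) (𝓝[>] 0)
      (𝓝 (Real.cosh (s * w) ^ (2 / s))) := by
    have hc : Continuous fun u : ℝ => Real.cosh (u / 2) ^ 2 *
      (Real.cosh (s * w - u / 2) / Real.cosh (u / 2)) ^ (2 / s) := by
      refine Continuous.mul (by fun_prop) (Continuous.rpow_const ?_ fun u => Or.inl ?_)
      · exact Continuous.div (by fun_prop) (by fun_prop) fun u => (Real.cosh_pos _).ne'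
      · have := Real.cosh_pos (u / 2)
        have := Real.cosh_pos (s * w - u / 2)
        positivity
    have := (hc.tendsto 0).mono_left (nhdsWithin_le_nhds (s := Set.Ioi 0))
    simpa using this
  exact le_of_tendsto_of_tendsto hl hr (eventually_mem_nhdsWithin.mono hle)

/-! ### The two-point inequality. -/

/-- Change of variables `a = c e^w`, `b = c e^{-w}`, `u = ln ((1 - p) / p)`; then `p` and `1 - p`
are `e^{∓u/2} / (2 cosh (u/2))`. -/
lemma two_point_of_cosh_sq_add_le {s u R w c : ℝ} (hs1 : 1 < s) (hc : 0 < c)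
    (h : Real.cosh (w - u / 2) ^ 2 + R * Real.sinh w ^ 2
      ≤ Real.cosh (u / 2) ^ 2 * (Real.cosh (s * w - u / 2) / Real.cosh (u / 2)) ^ (2 / s)) :
    (Real.exp (-(u / 2)) / (2 * Real.cosh (u / 2)) * (c * Real.exp w) +
        Real.exp (u / 2) / (2 * Real.cosh (u / 2)) * (c * Real.exp (-w))) ^ 2 +
      R * ((Real.exp (-(u / 2)) / (2 * Real.cosh (u / 2))) *
        (Real.exp (u / 2) / (2 * Real.cosh (u / 2)))) * (c * Real.exp w - c * Real.exp (-w)) ^ 2 ≤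
      (Real.exp (-(u / 2)) / (2 * Real.cosh (u / 2)) * (c * Real.exp w) ^ s +
        Real.exp (u / 2) / (2 * Real.cosh (u / 2)) * (c * Real.exp (-w)) ^ s) ^ (2 / s) := by
  have hs0 : 0 < s := by linarith
  have hC : 0 < Real.cosh (u / 2) := Real.cosh_pos _
  have e1 : Real.exp (-(u / 2)) / (2 * Real.cosh (u / 2)) * (c * Real.exp w) +
      Real.exp (u / 2) / (2 * Real.cosh (u / 2)) * (c * Real.exp (-w))
      = c * Real.cosh (w - u / 2) / Real.cosh (u / 2) := by
    rw [Real.cosh_eq (w - u / 2), show -(w - u / 2) = u / 2 + -w by ring,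
      show w - u / 2 = -(u / 2) + w by ring, Real.exp_add, Real.exp_add]
    field_simp
  have e2 : Real.exp (-(u / 2)) / (2 * Real.cosh (u / 2)) * (c * Real.exp w) ^ s +
      Real.exp (u / 2) / (2 * Real.cosh (u / 2)) * (c * Real.exp (-w)) ^ s
      = c ^ s * (Real.cosh (s * w - u / 2) / Real.cosh (u / 2)) := by
    rw [Real.mul_rpow hc.le (Real.exp_pos _).le, Real.mul_rpow hc.le (Real.exp_pos _).le,
      ← Real.exp_mul, ← Real.exp_mul,
      Real.cosh_eq (s * w - u / 2), show -(s * w - u / 2) = u / 2 + -w * s by ring,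
      show s * w - u / 2 = -(u / 2) + w * s by ring, Real.exp_add, Real.exp_add]
    field_simp
  have e3 : (Real.exp (-(u / 2)) / (2 * Real.cosh (u / 2))) *
      (Real.exp (u / 2) / (2 * Real.cosh (u / 2))) * (c * Real.exp w - c * Real.exp (-w)) ^ 2
      = c ^ 2 * Real.sinh w ^ 2 / Real.cosh (u / 2) ^ 2 := by
    have h1 : Real.exp (-(u / 2)) * Real.exp (u / 2) = 1 := by rw [← Real.exp_add]; simp
    rw [Real.sinh_eq, div_mul_div_comm, h1]
    field_simp
  rw [mul_assoc R, e3, e1, e2, Real.mul_rpow (by positivity) (by positivity), ← Real.rpow_mul hc.le,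
    show s * (2 / s) = 2 by field_simp, Real.rpow_two]
  generalize (Real.cosh (s * w - u / 2) / Real.cosh (u / 2)) ^ (2 / s) = T at h ⊢
  generalize Real.cosh (w - u / 2) = X at h ⊢
  calc _ = c ^ 2 / Real.cosh (u / 2) ^ 2 *
        (X ^ 2 + R * Real.sinh w ^ 2) := by field_simp
    _ ≤ c ^ 2 / Real.cosh (u / 2) ^ 2 * (Real.cosh (u / 2) ^ 2 * T) := by gcongr
    _ = _ := by field_simp

/-- Square of the optimal noise rate making the noise operator of the `p`-biased two-point space a
contraction from `L^s` to `L^2`. -/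
noncomputable def optimalRate (p s : ℝ) : ℝ :=
  if p = 1 / 2 then s - 1 else
    Real.sinh (Real.log ((1 - p) / p) - Real.log ((1 - p) / p) / s) /
      Real.sinh (Real.log ((1 - p) / p) / s)

lemma two_point_le_half {p s a b R : ℝ} (hp0 : 0 < p) (hp : p ≤ 1 / 2) (hs1 : 1 < s) (hs2 : s < 2)
    (ha : 0 < a) (hb : 0 < b) (hR : R ≤ optimalRate p s) :
    (p * a + (1 - p) * b) ^ 2 + R * (p * (1 - p)) * (a - b) ^ 2 ≤
      (p * a ^ s + (1 - p) * b ^ s) ^ (2 / s) := by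
  set u := Real.log ((1 - p) / p) with hu
  have hq : 0 < 1 - p := by linarith
  have heu : Real.exp u = (1 - p) / p := Real.exp_log (by positivity)
  have hE : Real.exp (u / 2) * Real.exp (u / 2) = (1 - p) / p := by
    rw [← Real.exp_add, add_halves, heu]
  have hEn : Real.exp (-(u / 2)) * Real.exp (u / 2) = 1 := by rw [← Real.exp_add]; simp
  have hZ : 2 * Real.cosh (u / 2) = Real.exp (u / 2) + Real.exp (-(u / 2)) := by
    rw [Real.cosh_eq]; ring
  have hE0 := Real.exp_pos (u / 2)
  have hZE : 2 * Real.cosh (u / 2) * Real.exp (u / 2) = 1 / p := by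
    rw [hZ, add_mul, hE, hEn]; field_simp; ring
  have hZ0 : 0 < 2 * Real.cosh (u / 2) := by positivity
  have hp' : Real.exp (-(u / 2)) / (2 * Real.cosh (u / 2)) = p := by
    rw [div_eq_iff hZ0.ne', ← mul_right_inj' hE0.ne', mul_comm, hEn]
    calc (1 : ℝ) = p * (1 / p) := by field_simp
      _ = _ := by rw [← hZE]; ring
  have hq' : Real.exp (u / 2) / (2 * Real.cosh (u / 2)) = 1 - p := by
    rw [← hp', eq_sub_iff_add_eq, ← add_div, ← hZ, div_self hZ0.ne']
  have hw : Real.exp (Real.log (a / b) / 2) = √(a / b) := by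
    rw [Real.exp_half, Real.exp_log (by positivity)]
  have ha' : √(a * b) * Real.exp (Real.log (a / b) / 2) = a := by
    rw [hw, ← Real.sqrt_mul (by positivity), show a * b * (a / b) = a * a by field_simp,
      Real.sqrt_mul_self ha.le]
  have hb' : √(a * b) * Real.exp (-(Real.log (a / b) / 2)) = b := by
    rw [Real.exp_neg, hw, ← Real.sqrt_inv, ← Real.sqrt_mul (by positivity),
      show a * b * (a / b)⁻¹ = b * b by field_simp, Real.sqrt_mul_self hb.le]
  have hmain := two_point_of_cosh_sq_add_le (s := s) (u := u) (R := R)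
    (w := Real.log (a / b) / 2) (c := √(a * b)) hs1 (by positivity) ?_
  · rwa [hp', hq', ha', hb'] at hmain
  · rcases hp.eq_or_lt with h | h
    · have hu0 : u = 0 := by rw [hu, h]; norm_num
      rw [optimalRate, if_pos h] at hR
      rw [hu0]
      simp only [zero_div, sub_zero, Real.cosh_zero, one_pow, one_mul, div_one]
      refine le_trans ?_ (cosh_sq_add_le_of_zero hs1 hs2 _)
      gcongr
    · have hu0 : 0 < u := Real.log_pos (by rw [lt_div_iff₀ hp0]; linarith)
      rw [optimalRate, if_neg h.ne, ← hu] at hR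
      refine le_trans ?_ (cosh_sq_add_le hs1 hs2 hu0 _)
      gcongr

lemma optimalRate_one_sub {p : ℝ} (hp1 : p < 1) (s : ℝ) :
    optimalRate (1 - p) s = optimalRate p s := by
  have hq : 0 < 1 - p := by linarith
  unfold optimalRate
  by_cases h : p = 1 / 2
  · rw [if_pos h, if_pos (by linarith)]
  · have h' : ¬ (1 - p = 1 / 2) := fun h' => h (by linarith)
    rw [if_neg h, if_neg h', sub_sub_cancel,
      show Real.log (p / (1 - p)) = -Real.log ((1 - p) / p) by
        rw [← Real.log_inv, inv_div], neg_div, ← neg_add', Real.sinh_neg]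
    simp [Real.sinh_neg, neg_div_neg_eq, sub_eq_add_neg]

/-- The optimal two-point hypercontractive inequality. -/
lemma two_point {p s a b R : ℝ} (hp0 : 0 < p) (hp1 : p < 1) (hs1 : 1 < s) (hs2 : s < 2)
    (ha : 0 ≤ a) (hb : 0 ≤ b) (hR : R ≤ optimalRate p s) :
    (p * a + (1 - p) * b) ^ 2 + R * (p * (1 - p)) * (a - b) ^ 2 ≤
      (p * a ^ s + (1 - p) * b ^ s) ^ (2 / s) := by
  have hq : 0 < 1 - p := by linarith
  have hpos : ∀ a b : ℝ, 0 < a → 0 < b →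
      (p * a + (1 - p) * b) ^ 2 + R * (p * (1 - p)) * (a - b) ^ 2 ≤
        (p * a ^ s + (1 - p) * b ^ s) ^ (2 / s) := by
    intro a b ha hb
    rcases le_total p (1 / 2) with h | h
    · exact two_point_le_half hp0 h hs1 hs2 ha hb hR
    · rw [← optimalRate_one_sub hp1] at hR
      have := two_point_le_half hq (by linarith) hs1 hs2 hb ha hR
      rw [sub_sub_cancel] at this
      convert this using 1
      · ring
      · rw [add_comm]
  have hs : 0 ≤ s := by linarith
  have h2s : 0 ≤ 2 / s := by positivity
  -- Vanishing values are reached by shifting both `a` and `b` by `ε` and letting `ε` decrease to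
  -- `0`.
  have hl : Continuous fun ε : ℝ => (p * (a + ε) + (1 - p) * (b + ε)) ^ 2 +
      R * (p * (1 - p)) * ((a + ε) - (b + ε)) ^ 2 := by fun_prop
  have hr : Continuous fun ε : ℝ => (p * (a + ε) ^ s + (1 - p) * (b + ε) ^ s) ^ (2 / s) := by
    refine Continuous.rpow_const ?_ fun _ => Or.inr h2s
    refine Continuous.add (Continuous.mul continuous_const ?_) (Continuous.mul continuous_const ?_)
    · exact Continuous.rpow_const (by fun_prop) fun _ => Or.inr hs
    · exact Continuous.rpow_const (by fun_prop) fun _ => Or.inr hs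
  have hl' := (hl.tendsto 0).mono_left (nhdsWithin_le_nhds (s := Set.Ioi 0))
  have hr' := (hr.tendsto 0).mono_left (nhdsWithin_le_nhds (s := Set.Ioi 0))
  simp only [add_zero] at hl' hr'
  refine le_of_tendsto_of_tendsto hl' hr' (eventually_mem_nhdsWithin.mono fun ε hε => ?_)
  have hε : 0 < ε := hε
  exact hpos _ _ (by positivity) (by positivity)

/-! ### Comparison of the three smoothing parameters with the optimal rate. -/

lemma optimalRate_minProb {p : ℝ} (hp1 : p < 1) (s : ℝ) :
    optimalRate (minProb p) s = optimalRate p s := by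
  unfold minProb
  rcases min_choice p (1 - p) with h | h <;> rw [h]
  exact optimalRate_one_sub hp1 s

lemma minProb_pos {p : ℝ} (hp0 : 0 < p) (hp1 : p < 1) : 0 < minProb p :=
  lt_min hp0 (by linarith)

lemma minProb_le_half (p : ℝ) : minProb p ≤ 1 / 2 := by
  unfold minProb
  rcases le_total p (1 / 2) with h | h
  · exact (min_le_left _ _).trans h
  · exact (min_le_right _ _).trans (by linarith)

lemma minProb_eq_half_iff {p : ℝ} : minProb p = 1 / 2 ↔ p = 1 / 2 := by
  constructor
  · intro h
    have h1 : minProb p ≤ p := min_le_left _ _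
    have h2 : minProb p ≤ 1 - p := min_le_right _ _
    linarith
  · rintro rfl
    norm_num [minProb]

lemma rhoPower_sq {p q : ℝ} (hp0 : 0 < p) (hp1 : p < 1) :
    rhoPower p q ^ 2 = minProb p ^ (1 - 2 / q) := by
  rw [rhoPower, ← Real.rpow_natCast, ← Real.rpow_mul (minProb_pos hp0 hp1).le]
  congr 1
  push_cast
  ring

lemma rhoConst_sq {p : ℝ} (hp0 : 0 < p) (hp1 : p < 1) (q : ℝ) :
    rhoConst p q ^ 2 = minProb p / (1 - minProb p) := by
  have := minProb_pos hp0 hp1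
  have := minProb_le_half p
  rw [rhoConst, Real.sq_sqrt (div_nonneg (by linarith) (by linarith))]

/-- The squares of the three smoothing parameters, divided by `e ^ α`, are at most the optimal
rate. -/
lemma smoothing_sq_le_optimalRate {p : ℝ} (hp0 : 0 < p) (hp1 : p < 1) {ρ : ℝ → ℝ}
    (hρ : ρ = rhoPower p ∨ ρ = rhoSinh p ∨ ρ = rhoConst p) {α : ℝ} (hα : 0 < α) :
    0 < ρ (Real.exp α + 1) ^ 2 ∧
      ρ (Real.exp α + 1) ^ 2 * Real.exp (-α) ≤ optimalRate p (1 + Real.exp (-α)) := by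
  have hl0 := minProb_pos hp0 hp1
  have hl1 := minProb_le_half p
  have hE1 : 1 < Real.exp α := Real.one_lt_exp_iff.2 hα
  have hq1 : 0 ≤ 1 - 2 / (Real.exp α + 1) := by
    rw [sub_nonneg, div_le_one (by linarith)]; linarith
  have hpow0 : 0 < minProb p ^ (1 - 2 / (Real.exp α + 1)) := by positivity
  have hconst0 : 0 < minProb p / (1 - minProb p) := div_pos hl0 (by linarith)
  rcases hl1.eq_or_lt with h | h
  · have hp : p = 1 / 2 := minProb_eq_half_iff.1 h
    -- In the unbiased case it suffices that each `ρ²` is in `(0, 1]`.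
    have hopt : optimalRate p (1 + Real.exp (-α)) = Real.exp (-α) := by
      rw [optimalRate, if_pos hp]; ring
    rw [hopt]
    have key : ∀ x : ℝ, 0 < x → x ≤ 1 → 0 < x ∧ x * Real.exp (-α) ≤ Real.exp (-α) :=
      fun x h0 h1 => ⟨h0, mul_le_of_le_one_left (Real.exp_pos _).le h1⟩
    rcases hρ with rfl | rfl | rfl
    · rw [rhoPower_sq hp0 hp1]
      exact key _ hpow0 (Real.rpow_le_one hl0.le (by linarith) hq1)
    · rw [rhoSinh, if_pos hp]
      exact key _ (by norm_num) (by norm_num)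
    · rw [rhoConst_sq hp0 hp1]
      exact key _ hconst0 (by rw [div_le_one] <;> linarith)
  · have hp : ¬ p = 1 / 2 := fun hp => h.ne (minProb_eq_half_iff.2 hp)
    rw [← optimalRate_minProb hp1, optimalRate, if_neg h.ne]
    set l := minProb p with hl
    set u := Real.log ((1 - l) / l) with hu
    have hu0 : 0 < u := Real.log_pos (by rw [lt_div_iff₀ hl0]; linarith)
    have hun : Real.log (l / (1 - l)) = -u := by rw [hu, ← Real.log_inv, inv_div]
    have heE : Real.exp (-α) = (Real.exp α)⁻¹ := Real.exp_neg α
    set E := Real.exp α with hE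
    -- The exponents `s = 1 + e^{-α}` and `q = e^α + 1` are conjugate, so `1 / s = 1 - 1 / q`.
    have hb : u / (1 + Real.exp (-α)) = u * (1 - 1 / (E + 1)) := by
      rw [heE]; field_simp; ring
    have ha : u - u / (1 + Real.exp (-α)) = u * (1 / (E + 1)) := by rw [hb]; ring
    have ha0 : 0 < u * (1 / (E + 1)) := by positivity
    have hab : u * (1 / (E + 1)) ≤ u * (1 - 1 / (E + 1)) := by
      refine mul_le_mul_of_nonneg_left ?_ hu0.le
      have : 2 / (E + 1) = 1 / (E + 1) + 1 / (E + 1) := by ring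
      linarith
    rw [ha, hb]
    have hratio := mul_exp_le_sinh_div_sinh ha0 hab
    have hdiv : u * (1 / (E + 1)) / (u * (1 - 1 / (E + 1))) = Real.exp (-α) := by
      rw [heE]
      have : (1 - 1 / (E + 1)) = E / (E + 1) := by field_simp; ring
      rw [this]; field_simp
    rw [hdiv, show u * (1 - 1 / (E + 1)) - u * (1 / (E + 1)) = u * (1 - 2 / (E + 1)) by ring]
      at hratio
    have hsa : 0 < Real.sinh (u * (1 / (E + 1))) := Real.sinh_pos_iff.2 ha0
    have hsb : 0 < Real.sinh (u * (1 - 1 / (E + 1))) := Real.sinh_pos_iff.2 (ha0.trans_le hab)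
    -- For the first and third parameters it is enough that `ρ² ≤ e^{-u (1 - 2/q)}`: the first has
    -- `λ ≤ e^{-u}` as base, the third has `ρ² = e^{-u}`.
    have key : ∀ x : ℝ, 0 < x → x ≤ Real.exp (-(u * (1 - 2 / (E + 1)))) → 0 < x ∧
        x * Real.exp (-α) ≤ Real.sinh (u * (1 / (E + 1))) / Real.sinh (u * (1 - 1 / (E + 1))) :=
      fun x h0 h1 => ⟨h0, by
        rw [mul_comm]
        exact (mul_le_mul_of_nonneg_left h1 (Real.exp_pos _).le).trans hratio⟩
    rcases hρ with rfl | rfl | rfl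
    · rw [rhoPower_sq hp0 hp1]
      refine key _ hpow0 ?_
      rw [Real.rpow_def_of_pos hl0, Real.exp_le_exp]
      have h1 : Real.log l ≤ -u := by
        rw [← hun, Real.log_div hl0.ne' (by linarith)]
        have : Real.log (1 - l) ≤ 0 := Real.log_nonpos (by linarith) (by linarith)
        linarith
      have := mul_le_mul_of_nonneg_right h1 hq1
      linarith
    -- For the second parameter equality holds: the factor `q - 1 = e^α` cancels `e^{-α}`.
    · rw [rhoSinh, if_neg hp, ← hl, hun, mul_pow, Real.sq_sqrt (by linarith),
        show -(1 / (E + 1)) * -u = u * (1 / (E + 1)) by ring,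
        show -(1 - 1 / (E + 1)) * -u = u * (1 - 1 / (E + 1)) by ring,
        Real.sq_sqrt (by positivity), add_sub_cancel_right, heE]
      exact ⟨by positivity, le_of_eq (by field_simp)⟩
    · rw [rhoConst_sq hp0 hp1]
      refine key _ hconst0 ?_
      rw [← Real.exp_log hconst0, hun, Real.exp_le_exp, neg_le_neg_iff]
      refine mul_le_of_le_one_right hu0.le ?_
      have : 0 < 2 / (E + 1) := by positivity
      linarith

/-! ### Fourier expansion and noise energy. -/

lemma sum_cube_insertNth {n : ℕ} (i : Fin (n + 1)) (F : Cube (n + 1) → ℝ) :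
    ∑ x, F x = ∑ y : Cube n, (F (i.insertNth 1 y) + F (i.insertNth (-1) y)) := by
  rw [← (Fin.insertNthEquiv (fun _ => ℤˣ) i).sum_comp, Fintype.sum_prod_type, UnitsInt.univ,
    Finset.sum_pair (by decide), Finset.sum_add_distrib]
  rfl

lemma sum_bool_insertNth {n : ℕ} (i : Fin (n + 1)) (F : (Fin (n + 1) → Bool) → ℝ) :
    ∑ S, F S = ∑ T : Fin n → Bool, (F (i.insertNth true T) + F (i.insertNth false T)) := by
  rw [← (Fin.insertNthEquiv (fun _ => Bool) i).sum_comp, Fintype.sum_prod_type, Fintype.sum_bool,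
    Finset.sum_add_distrib]
  rfl

lemma expect_insertNth (p : ℝ) {n : ℕ} (i : Fin (n + 1)) (f : Cube (n + 1) → ℝ) :
    expect p f = p * expect p (fun y => f (i.insertNth 1 y)) +
      (1 - p) * expect p (fun y => f (i.insertNth (-1) y)) := by
  have h : ¬ ((-1 : ℤˣ) = 1) := by decide
  unfold expect mass
  rw [sum_cube_insertNth i, Finset.mul_sum, Finset.mul_sum, ← Finset.sum_add_distrib]
  refine Finset.sum_congr rfl fun y _ => ?_
  simp only [Fin.prod_univ_succAbove _ i, Fin.insertNth_apply_same,
    Fin.insertNth_apply_succAbove, coordWeight, if_true, if_neg h]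
  ring

/-- Values of the orthonormal basis of the two-point space, times the mass of the point. -/
noncomputable def fourierKernel (p : ℝ) : Bool → ℤˣ → ℝ
  | false, s => coordWeight p s
  | true, s => if s = 1 then √(p * (1 - p)) else -√(p * (1 - p))

/-- Fourier coefficients with respect to the product orthonormal basis; the set of active
coordinates is given by its indicator `S`. -/
noncomputable def fourierCoeff (p : ℝ) {n : ℕ} (f : Cube n → ℝ) (S : Fin n → Bool) : ℝ :=
  ∑ x, f x * ∏ i, fourierKernel p (S i) (x i)

/-- The weight `R ^ |S|`. -/
def levelWeight (R : ℝ) {n : ℕ} (S : Fin n → Bool) : ℝ := ∏ i, if S i then R else 1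

/-- The energy `∑ R ^ |S| * \hat f(S) ^ 2`. -/
noncomputable def noiseEnergy (p R : ℝ) {n : ℕ} (f : Cube n → ℝ) : ℝ :=
  ∑ S, levelWeight R S * fourierCoeff p f S ^ 2

lemma fourierCoeff_insertNth (p : ℝ) {n : ℕ} (i : Fin (n + 1)) (f : Cube (n + 1) → ℝ)
    (b : Bool) (S : Fin n → Bool) :
    fourierCoeff p f (i.insertNth b S) =
      fourierKernel p b 1 * fourierCoeff p (fun y => f (i.insertNth 1 y)) S +
      fourierKernel p b (-1) * fourierCoeff p (fun y => f (i.insertNth (-1) y)) S := by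
  unfold fourierCoeff
  rw [sum_cube_insertNth i, Finset.mul_sum, Finset.mul_sum, ← Finset.sum_add_distrib]
  refine Finset.sum_congr rfl fun y _ => ?_
  simp only [Fin.prod_univ_succAbove _ i, Fin.insertNth_apply_same,
    Fin.insertNth_apply_succAbove]
  ring

lemma fourierCoeff_linear (p c d : ℝ) {n : ℕ} (f g : Cube n → ℝ) (S : Fin n → Bool) :
    fourierCoeff p (fun x => c * f x + d * g x) S =
      c * fourierCoeff p f S + d * fourierCoeff p g S := by
  unfold fourierCoeff
  rw [Finset.mul_sum, Finset.mul_sum, ← Finset.sum_add_distrib]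
  exact Finset.sum_congr rfl fun y _ => by ring

lemma coordDiff_insertNth_one (p : ℝ) {n : ℕ} (i : Fin (n + 1)) (f : Cube (n + 1) → ℝ)
    (y : Cube n) : coordDiff p i f (i.insertNth 1 y) =
      (1 - p) * f (i.insertNth 1 y) + -(1 - p) * f (i.insertNth (-1) y) := by
  simp only [coordDiff, coordExpect, Pi.sub_apply, Fin.update_insertNth]
  ring

lemma coordDiff_insertNth_neg_one (p : ℝ) {n : ℕ} (i : Fin (n + 1)) (f : Cube (n + 1) → ℝ)
    (y : Cube n) : coordDiff p i f (i.insertNth (-1) y) =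
      -p * f (i.insertNth 1 y) + p * f (i.insertNth (-1) y) := by
  simp only [coordDiff, coordExpect, Pi.sub_apply, Fin.update_insertNth]
  ring

/-- `E_i` is the projection onto the basis functions that do not depend on coordinate `i`. -/
lemma fourierCoeff_coordDiff (p : ℝ) {n : ℕ} (i : Fin n) (f : Cube n → ℝ) (S : Fin n → Bool) :
    fourierCoeff p (coordDiff p i f) S = if S i then fourierCoeff p f S else 0 := by
  cases n with
  | zero => exact i.elim0
  | succ n =>
    have h : ¬ ((-1 : ℤˣ) = 1) := by decide
    obtain ⟨b, T, rfl⟩ : ∃ (b : Bool) (T : Fin n → Bool), S = i.insertNth b T :=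
      ⟨S i, i.removeNth S, (Fin.insertNth_self_removeNth i S).symm⟩
    simp only [fourierCoeff_insertNth, coordDiff_insertNth_one,
      coordDiff_insertNth_neg_one, fourierCoeff_linear, Fin.insertNth_apply_same]
    cases b
    · simp only [fourierKernel, coordWeight, if_true, if_neg h, Bool.false_eq_true, if_false]
      ring
    · simp only [fourierKernel, if_true, if_neg h]
      ring

lemma levelWeight_nonneg {R : ℝ} (hR : 0 ≤ R) {n : ℕ} (S : Fin n → Bool) : 0 ≤ levelWeight R S :=
  Finset.prod_nonneg fun i _ => by split_ifs <;> linarith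

lemma noiseEnergy_nonneg (p : ℝ) {R : ℝ} (hR : 0 ≤ R) {n : ℕ} (f : Cube n → ℝ) :
    0 ≤ noiseEnergy p R f :=
  Finset.sum_nonneg fun S _ => mul_nonneg (levelWeight_nonneg hR S) (sq_nonneg _)

lemma noiseEnergy_zero (p R : ℝ) (f : Cube 0 → ℝ) : noiseEnergy p R f = f default ^ 2 := by
  simp only [noiseEnergy, levelWeight, fourierCoeff, Finset.univ_unique, Finset.sum_singleton,
    Finset.univ_eq_empty, Finset.prod_empty, mul_one, one_mul]
  exact congrArg (fun x => f x ^ 2) (Subsingleton.elim _ _)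

/-- Expanding in one coordinate gives the energy of the mean of the two restrictions plus `R p (1 -
p)` times the energy of their difference. The form here eliminates the difference, leaving only a
mean of functions and a mean of energies for the induction. -/
lemma noiseEnergy_succ {p : ℝ} (hp0 : 0 < p) (hp1 : p < 1) (R : ℝ) {n : ℕ}
    (f : Cube (n + 1) → ℝ) :
    noiseEnergy p R f =
      (1 - R) * noiseEnergy p R (fun y => p * f (Fin.insertNth 0 1 y) +
        (1 - p) * f (Fin.insertNth 0 (-1) y)) +
      R * (p * noiseEnergy p R (fun y => f (Fin.insertNth 0 1 y)) +
        (1 - p) * noiseEnergy p R (fun y => f (Fin.insertNth 0 (-1) y))) := by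
  have h : ¬ ((-1 : ℤˣ) = 1) := by decide
  have hsq : √(p * (1 - p)) ^ 2 = p * (1 - p) :=
    Real.sq_sqrt (mul_nonneg hp0.le (by linarith))
  unfold noiseEnergy
  rw [sum_bool_insertNth 0, Finset.mul_sum, Finset.mul_sum, Finset.mul_sum,
    ← Finset.sum_add_distrib, Finset.mul_sum, ← Finset.sum_add_distrib]
  refine Finset.sum_congr rfl fun S _ => ?_
  simp only [fourierCoeff_insertNth, fourierCoeff_linear, levelWeight,
    Fin.prod_univ_succAbove _ 0, Fin.insertNth_apply_same, Fin.insertNth_apply_succAbove,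
    fourierKernel, coordWeight, if_true, if_neg h, Bool.false_eq_true, if_false]
  linear_combination R * (∏ x, if S x = true then R else 1) *
    (fourierCoeff p (fun y => f (Fin.insertNth 0 1 y)) S -
      fourierCoeff p (fun y => f (Fin.insertNth 0 (-1) y)) S) ^ 2 * hsq

/-- Parseval's identity. -/
lemma noiseEnergy_one {p : ℝ} (hp0 : 0 < p) (hp1 : p < 1) {n : ℕ} (f : Cube n → ℝ) :
    noiseEnergy p 1 f = expect p (fun x => f x ^ 2) := by
  induction n with
  | zero =>
    simp only [noiseEnergy_zero, expect, mass, Finset.univ_unique, Finset.sum_singleton,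
      Finset.univ_eq_empty, Finset.prod_empty, mul_one]
    exact congrArg (fun x => f x ^ 2) (Subsingleton.elim _ _)
  | succ n ih => rw [noiseEnergy_succ hp0 hp1, ih, ih, ih, expect_insertNth p 0]; ring

/-! ### Hypercontractivity on the cube. -/

/-- The square root of the energy is a seminorm: Cauchy–Schwarz controls the cross term. -/
lemma noiseEnergy_add_le {p R : ℝ} (hp0 : 0 < p) (hp1 : p < 1) (hR : 0 ≤ R) {n : ℕ}
    (f g : Cube n → ℝ) :
    noiseEnergy p R (fun y => p * f y + (1 - p) * g y) ≤
      (p * √(noiseEnergy p R f) + (1 - p) * √(noiseEnergy p R g)) ^ 2 := by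
  have hq : 0 < 1 - p := by linarith
  have hf := noiseEnergy_nonneg p hR f
  have hg := noiseEnergy_nonneg p hR g
  have hcs : (∑ S, levelWeight R S * (fourierCoeff p f S * fourierCoeff p g S)) ^ 2 ≤
      noiseEnergy p R f * noiseEnergy p R g :=
    Finset.sum_sq_le_sum_mul_sum_of_sq_le_mul _
      (fun S _ => mul_nonneg (levelWeight_nonneg hR S) (sq_nonneg _))
      (fun S _ => mul_nonneg (levelWeight_nonneg hR S) (sq_nonneg _)) fun S _ => le_of_eq (by ring)
  have hle : ∑ S, levelWeight R S * (fourierCoeff p f S * fourierCoeff p g S) ≤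
      √(noiseEnergy p R f) * √(noiseEnergy p R g) := by
    rw [← Real.sqrt_mul hf]
    exact Real.le_sqrt_of_sq_le hcs
  have hexp : noiseEnergy p R (fun y => p * f y + (1 - p) * g y) =
      p ^ 2 * noiseEnergy p R f + (1 - p) ^ 2 * noiseEnergy p R g +
      2 * (p * (1 - p)) * ∑ S, levelWeight R S * (fourierCoeff p f S * fourierCoeff p g S) := by
    unfold noiseEnergy
    rw [Finset.mul_sum, Finset.mul_sum, Finset.mul_sum, ← Finset.sum_add_distrib,
      ← Finset.sum_add_distrib]
    refine Finset.sum_congr rfl fun S _ => ?_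
    rw [fourierCoeff_linear]
    ring
  have h1 := Real.sq_sqrt hf
  have h2 := Real.sq_sqrt hg
  have h3 := mul_le_mul_of_nonneg_left hle (show 0 ≤ 2 * (p * (1 - p)) by positivity)
  rw [hexp]
  linear_combination h3 - p ^ 2 * h1 - (1 - p) ^ 2 * h2

lemma coordWeight_pos {p : ℝ} (hp0 : 0 < p) (hp1 : p < 1) (s : ℤˣ) : 0 < coordWeight p s := by
  unfold coordWeight; split_ifs <;> linarith

lemma mass_pos {p : ℝ} (hp0 : 0 < p) (hp1 : p < 1) {n : ℕ} (x : Cube n) : 0 < mass p x :=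
  Finset.prod_pos fun _ _ => coordWeight_pos hp0 hp1 _

lemma expect_nonneg {p : ℝ} (hp0 : 0 < p) (hp1 : p < 1) {n : ℕ} {f : Cube n → ℝ}
    (hf : ∀ x, 0 ≤ f x) : 0 ≤ expect p f :=
  Finset.sum_nonneg fun x _ => mul_nonneg (hf x) (mass_pos hp0 hp1 x).le

/-- Hypercontractivity for the `p`-biased measure. -/
lemma noiseEnergy_le {p s R : ℝ} (hp0 : 0 < p) (hp1 : p < 1) (hs1 : 1 < s) (hs2 : s < 2)
    (hR0 : 0 ≤ R) (hR1 : R ≤ 1) (hR : R ≤ optimalRate p s) {n : ℕ} (f : Cube n → ℝ) :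
    noiseEnergy p R f ≤ (expect p fun x => |f x| ^ s) ^ (2 / s) := by
  have hq : 0 < 1 - p := by linarith
  have hs0 : 0 < s := by linarith
  induction n with
  | zero =>
    simp only [noiseEnergy_zero, expect, mass, Finset.univ_unique, Finset.sum_singleton,
      Finset.univ_eq_empty, Finset.prod_empty, mul_one]
    rw [← Real.rpow_mul (abs_nonneg _), show s * (2 / s) = 2 by field_simp, Real.rpow_two, sq_abs]
    exact (congrArg (fun x => f x ^ 2) (Subsingleton.elim _ _)).le
  | succ n ih =>
    set g : Cube n → ℝ := fun y => f (Fin.insertNth 0 1 y)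
    set h : Cube n → ℝ := fun y => f (Fin.insertNth 0 (-1) y)
    have key : ∀ k : Cube n → ℝ, √(noiseEnergy p R k) ^ s ≤ expect p fun x => |k x| ^ s := by
      intro k
      have h0 : 0 ≤ expect p fun x => |k x| ^ s := expect_nonneg hp0 hp1 fun x => by positivity
      have h1 := Real.rpow_le_rpow (noiseEnergy_nonneg p hR0 k) (ih k)
        (show 0 ≤ s / 2 by positivity)
      rw [← Real.rpow_mul h0, show 2 / s * (s / 2) = 1 by field_simp, Real.rpow_one] at h1
      rwa [Real.sqrt_eq_rpow, ← Real.rpow_mul (noiseEnergy_nonneg p hR0 k),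
        show 1 / 2 * s = s / 2 by ring]
    have ha := Real.sqrt_nonneg (noiseEnergy p R g)
    have hb := Real.sqrt_nonneg (noiseEnergy p R h)
    have h1 := Real.sq_sqrt (noiseEnergy_nonneg p hR0 g)
    have h2 := Real.sq_sqrt (noiseEnergy_nonneg p hR0 h)
    calc noiseEnergy p R f = (1 - R) * noiseEnergy p R (fun y => p * g y + (1 - p) * h y) +
          R * (p * noiseEnergy p R g + (1 - p) * noiseEnergy p R h) := noiseEnergy_succ hp0 hp1 R f
      _ ≤ (1 - R) * (p * √(noiseEnergy p R g) + (1 - p) * √(noiseEnergy p R h)) ^ 2 +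
          R * (p * noiseEnergy p R g + (1 - p) * noiseEnergy p R h) := by
        have := noiseEnergy_add_le hp0 hp1 hR0 g h
        have := sub_nonneg.2 hR1
        gcongr
      -- This is the left side of the two-point inequality for the numbers `√(noiseEnergy p R g)`
      -- and `√(noiseEnergy p R h)`.
      _ = (p * √(noiseEnergy p R g) + (1 - p) * √(noiseEnergy p R h)) ^ 2 +
          R * (p * (1 - p)) * (√(noiseEnergy p R g) - √(noiseEnergy p R h)) ^ 2 := by
        linear_combination (-R * p) * h1 - R * (1 - p) * h2
      _ ≤ (p * √(noiseEnergy p R g) ^ s + (1 - p) * √(noiseEnergy p R h) ^ s) ^ (2 / s) :=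
        two_point hp0 hp1 hs1 hs2 ha hb hR
      _ ≤ (p * (expect p fun x => |g x| ^ s) + (1 - p) * (expect p fun x => |h x| ^ s)) ^ (2 / s) := by
        have := key g
        have := key h
        gcongr
      _ = _ := by rw [expect_insertNth p 0]

/-! ### Variance, influences and the Talagrand-type inequality. -/

lemma expect_const (p : ℝ) {n : ℕ} (c : ℝ) : expect p (fun _ : Cube n => c) = c := by
  induction n with
  | zero => simp [expect, mass]
  | succ n ih => rw [expect_insertNth p 0, ih]; ring

lemma variance_eq (p : ℝ) {n : ℕ} (f : Cube n → ℝ) :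
    variance p f = expect p (fun x => f x ^ 2) - expect p f ^ 2 := by
  have h : ∀ m : ℝ, expect p (fun x => (f x - m) ^ 2) =
      expect p (fun x => f x ^ 2) - 2 * m * expect p f + expect p (fun _ : Cube n => m ^ 2) := by
    intro m
    unfold expect
    rw [Finset.mul_sum, ← Finset.sum_sub_distrib, ← Finset.sum_add_distrib]
    exact Finset.sum_congr rfl fun x _ => by ring
  rw [variance, h, expect_const]
  ring

/-- Number of active coordinates. -/
def degree {n : ℕ} (S : Fin n → Bool) : ℝ := ∑ i, if S i then 1 else 0

lemma levelWeight_exp (D : ℝ) {n : ℕ} (S : Fin n → Bool) :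
    levelWeight (Real.exp (-D)) S = Real.exp (-D * degree S) := by
  rw [degree, Finset.mul_sum, Real.exp_sum]
  refine Finset.prod_congr rfl fun i _ => ?_
  split_ifs <;> simp

lemma one_le_degree {n : ℕ} {S : Fin n → Bool} (hS : S ≠ fun _ => false) : 1 ≤ degree S := by
  obtain ⟨i, hi⟩ : ∃ i, S i = true := by
    by_contra! h
    exact hS (funext fun i => by simpa using h i)
  calc (1 : ℝ) = if S i then 1 else 0 := by simp [hi]
    _ ≤ degree S := Finset.single_le_sum (f := fun i => if S i then (1 : ℝ) else 0)
      (fun j _ => by positivity) (Finset.mem_univ i)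

lemma degree_empty {n : ℕ} : degree (fun _ : Fin n => false) = 0 := by simp [degree]

/-- Each `S` is counted once for every active coordinate. -/
lemma sum_noiseEnergy_coordDiff (p R : ℝ) {n : ℕ} (f : Cube n → ℝ) :
    ∑ i, noiseEnergy p R (coordDiff p i f) =
      ∑ S, degree S * (levelWeight R S * fourierCoeff p f S ^ 2) := by
  unfold noiseEnergy
  rw [Finset.sum_comm]
  refine Finset.sum_congr rfl fun S _ => ?_
  rw [degree, Finset.sum_mul]
  refine Finset.sum_congr rfl fun i _ => ?_
  rw [fourierCoeff_coordDiff]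
  split_ifs <;> simp

lemma levelWeight_one {n : ℕ} (S : Fin n → Bool) : levelWeight 1 S = 1 := by simp [levelWeight]

lemma fourierCoeff_empty (p : ℝ) {n : ℕ} (f : Cube n → ℝ) :
    fourierCoeff p f (fun _ => false) = expect p f := rfl

lemma sum_expect_sq_coordDiff {p : ℝ} (hp0 : 0 < p) (hp1 : p < 1) {n : ℕ} (f : Cube n → ℝ) :
    ∑ i, expect p (fun x => coordDiff p i f x ^ 2) =
      ∑ S, degree S * fourierCoeff p f S ^ 2 := by
  simp_rw [← noiseEnergy_one hp0 hp1, sum_noiseEnergy_coordDiff, levelWeight_one, one_mul]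

lemma variance_eq_sum {p : ℝ} (hp0 : 0 < p) (hp1 : p < 1) {n : ℕ} (f : Cube n → ℝ) :
    variance p f = ∑ S : Fin n → Bool,
      if S = fun _ => false then 0 else fourierCoeff p f S ^ 2 := by
  have h : ∀ S : Fin n → Bool, (if S = fun _ => false then 0 else fourierCoeff p f S ^ 2) =
      fourierCoeff p f S ^ 2 - if S = fun _ => false then fourierCoeff p f S ^ 2 else 0 :=
    fun S => by split_ifs <;> ring
  rw [variance_eq, ← noiseEnergy_one hp0 hp1]
  simp_rw [h, Finset.sum_sub_distrib, Finset.sum_ite_eq', Finset.mem_univ, if_true, noiseEnergy,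
    levelWeight_one, one_mul, fourierCoeff_empty]

/-- A lower bound for the noisy total influence in terms of the average degree. -/
lemma variance_mul_exp_le {p D x : ℝ} (hp0 : 0 < p) (hp1 : p < 1) (hD : 0 ≤ D) {n : ℕ}
    (f : Cube n → ℝ)
    (hx : ∑ i, expect p (fun y => coordDiff p i f y ^ 2) ≤ x * variance p f) :
    variance p f * Real.exp (-D * x) ≤ ∑ i, noiseEnergy p (Real.exp (-D)) (coordDiff p i f) := by
  have hI := sum_expect_sq_coordDiff hp0 hp1 f
  have hV := variance_eq_sum hp0 hp1 f
  -- The convex function `y ↦ e^{-Dy}` lies above its tangent at `y = x`, and the extra factor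
  -- `degree S` is at least `1` off the empty set. The bound is linear in `degree S`, so summing it
  -- involves only the variance and the total influence.
  have hpt : ∀ S : Fin n → Bool,
      Real.exp (-D * x) * ((1 + D * x) * (if S = fun _ => false then 0 else fourierCoeff p f S ^ 2) -
        D * (degree S * fourierCoeff p f S ^ 2)) ≤
      degree S * (levelWeight (Real.exp (-D)) S * fourierCoeff p f S ^ 2) := by
    intro S
    rw [levelWeight_exp]
    split_ifs with h
    · simp [h, degree_empty]
    · have h1 := one_le_degree h
      have h2 : Real.exp (-D * x) * (1 + D * x - D * degree S) ≤ Real.exp (-D * degree S) := by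
        rw [show -D * degree S = -D * x + (D * x - D * degree S) by ring, Real.exp_add]
        have := Real.add_one_le_exp (D * x - D * degree S)
        gcongr
        linarith
      have h3 : Real.exp (-D * degree S) ≤ degree S * Real.exp (-D * degree S) :=
        le_mul_of_one_le_left (Real.exp_pos _).le h1
      have h4 := mul_le_mul_of_nonneg_right (h2.trans h3) (sq_nonneg (fourierCoeff p f S))
      linarith
  have hsum := Finset.sum_le_sum fun S (_ : S ∈ Finset.univ) => hpt S
  rw [← Finset.mul_sum, Finset.sum_sub_distrib, ← Finset.mul_sum, ← Finset.mul_sum, ← hV, ← hI,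
    ← sum_noiseEnergy_coordDiff] at hsum
  refine le_trans ?_ hsum
  rw [mul_comm]
  have := mul_le_mul_of_nonneg_left hx hD
  gcongr
  linarith

/-- Interpolation of the norm of `L^s` between those of `L^1` and `L^2`. -/
lemma expect_abs_rpow_le {p s : ℝ} (hp0 : 0 < p) (hp1 : p < 1) (hs1 : 1 < s) (hs2 : s < 2) {n : ℕ}
    (g : Cube n → ℝ) :
    (expect p fun x => |g x| ^ s) ≤
      (expect p fun x => |g x|) ^ (2 - s) * (expect p fun x => g x ^ 2) ^ (s - 1) := by
  have h1 : 0 < 2 - s := by linarith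
  have h2 : 0 < s - 1 := by linarith
  -- Hölder is applied to `|g|^s = |g|^(2 - s) * (g²)^(s - 1)`, with the mass split in the same
  -- proportions.
  have hconj : (1 / (2 - s)).HolderConjugate (1 / (s - 1)) := by
    rw [Real.holderConjugate_iff]
    constructor
    · rw [one_lt_div h1]; linarith
    · norm_num
  have hm := fun x : Cube n => mass_pos hp0 hp1 x
  have h := Real.inner_le_Lp_mul_Lq_of_nonneg Finset.univ hconj
    (f := fun x : Cube n => (|g x| * mass p x) ^ (2 - s))
    (g := fun x : Cube n => (g x ^ 2 * mass p x) ^ (s - 1))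
    (fun x _ => by have := hm x; positivity) (fun x _ => by have := hm x; positivity)
  have e1 : ∀ x : Cube n, ((|g x| * mass p x) ^ (2 - s)) ^ (1 / (2 - s)) = |g x| * mass p x :=
    fun x => by
      have := hm x
      rw [← Real.rpow_mul (by positivity), mul_one_div_cancel h1.ne', Real.rpow_one]
  have e2 : ∀ x : Cube n, ((g x ^ 2 * mass p x) ^ (s - 1)) ^ (1 / (s - 1)) = g x ^ 2 * mass p x :=
    fun x => by
      have := hm x
      rw [← Real.rpow_mul (by positivity), mul_one_div_cancel h2.ne', Real.rpow_one]
  have e3 : ∀ x : Cube n, (|g x| * mass p x) ^ (2 - s) * (g x ^ 2 * mass p x) ^ (s - 1) =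
      |g x| ^ s * mass p x := fun x => by
    have hmx := hm x
    have ha := abs_nonneg (g x)
    rw [Real.mul_rpow ha hmx.le, Real.mul_rpow (sq_nonneg _) hmx.le, ← sq_abs (g x),
      ← Real.rpow_two, ← Real.rpow_mul ha]
    rw [show |g x| ^ (2 - s) * mass p x ^ (2 - s) * (|g x| ^ (2 * (s - 1)) * mass p x ^ (s - 1)) =
      (|g x| ^ (2 - s) * |g x| ^ (2 * (s - 1))) * (mass p x ^ (2 - s) * mass p x ^ (s - 1)) by ring,
      ← Real.rpow_add hmx, ← Real.rpow_add_of_nonneg ha h1.le (by positivity),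
      show 2 - s + 2 * (s - 1) = s by ring, show 2 - s + (s - 1) = 1 by ring, Real.rpow_one]
  simp only [e1, e2, e3, one_div_one_div] at h
  exact h

lemma noiseEnergy_le_interpolate {p s R : ℝ} (hp0 : 0 < p) (hp1 : p < 1) (hs1 : 1 < s)
    (hs2 : s < 2) (hR0 : 0 ≤ R) (hR1 : R ≤ 1) (hR : R ≤ optimalRate p s) {n : ℕ}
    (g : Cube n → ℝ) :
    noiseEnergy p R g ≤ (expect p fun x => |g x|) ^ (2 * ((2 - s) / s)) *
      (expect p fun x => g x ^ 2) ^ (1 - (2 - s) / s) := by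
  have hs0 : 0 < s := by linarith
  have ha : 0 ≤ expect p fun x => |g x| := expect_nonneg hp0 hp1 fun x => abs_nonneg _
  have hb : 0 ≤ expect p fun x => g x ^ 2 := expect_nonneg hp0 hp1 fun x => sq_nonneg _
  have hc : 0 ≤ expect p fun x => |g x| ^ s := expect_nonneg hp0 hp1 fun x => by positivity
  refine (noiseEnergy_le hp0 hp1 hs1 hs2 hR0 hR1 hR g).trans ?_
  refine (Real.rpow_le_rpow hc (expect_abs_rpow_le hp0 hp1 hs1 hs2 g) (by positivity)).trans_eq ?_
  rw [Real.mul_rpow (by positivity) (by positivity), ← Real.rpow_mul ha, ← Real.rpow_mul hb]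
  congr 2
  · ring
  · field_simp; ring

/-- Talagrand-type inequality: uniform bounds on the `L^1`-influences control the variance. -/
lemma variance_mul_exp_le_of_influence_le {p s D M δ : ℝ} (hp0 : 0 < p) (hp1 : p < 1)
    (hs1 : 1 < s) (hs2 : s < 2) (hD : 0 ≤ D) (hR : Real.exp (-D) ≤ optimalRate p s) (hM : 0 ≤ M)
    (hδ : 0 ≤ δ) {n : ℕ} (f : Cube n → ℝ) (hV : 0 < variance p f)
    (h1 : ∀ i, (expect p fun x => |coordDiff p i f x|) ≤ δ)
    (h2 : ∀ i, (expect p fun x => coordDiff p i f x ^ 2) ≤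
      M * expect p fun x => |coordDiff p i f x|) :
    variance p f * Real.exp (-D * (n * (M * δ) / variance p f)) ≤
      n * (δ ^ (2 * ((2 - s) / s)) * (M * δ) ^ (1 - (2 - s) / s)) := by
  have hs0 : 0 < s := by linarith
  have ht0 : 0 ≤ (2 - s) / s := div_nonneg (by linarith) hs0.le
  have ht1 : 0 ≤ 1 - (2 - s) / s := by
    rw [sub_nonneg, div_le_one hs0]; linarith
  have h3 : ∀ i, (expect p fun x => coordDiff p i f x ^ 2) ≤ M * δ := fun i =>
    (h2 i).trans (mul_le_mul_of_nonneg_left (h1 i) hM)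
  refine (variance_mul_exp_le hp0 hp1 hD f ?_).trans ?_
  · rw [div_mul_cancel₀ _ hV.ne']
    refine (Finset.sum_le_sum fun i _ => h3 i).trans_eq ?_
    simp
  · refine (Finset.sum_le_sum fun i _ => (noiseEnergy_le_interpolate hp0 hp1 hs1 hs2
      (Real.exp_pos _).le (Real.exp_le_one_iff.2 (by linarith)) hR _).trans
      (mul_le_mul (Real.rpow_le_rpow ?_ (h1 i) (by positivity))
        (Real.rpow_le_rpow ?_ (h3 i) ht1) ?_ (by positivity))).trans_eq ?_
    · exact expect_nonneg hp0 hp1 fun x => abs_nonneg _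
    · exact expect_nonneg hp0 hp1 fun x => sq_nonneg _
    · exact Real.rpow_nonneg (expect_nonneg hp0 hp1 fun x => sq_nonneg _) _
    · simp

/-! ### Asymptotics in `n` and the passage to `M₀`. -/

lemma lqNorm_one (p : ℝ) {n : ℕ} (g : Cube n → ℝ) :
    lqNorm p 1 g = expect p fun x => |g x| := by
  simp [lqNorm]

lemma lqNorm_two_sq {p : ℝ} (hp0 : 0 < p) (hp1 : p < 1) {n : ℕ} (g : Cube n → ℝ) :
    lqNorm p 2 g ^ 2 = expect p fun x => g x ^ 2 := by
  have h : 0 ≤ expect p fun x => g x ^ 2 := expect_nonneg hp0 hp1 fun x => sq_nonneg _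
  simp only [lqNorm, Real.rpow_two, sq_abs]
  rw [← Real.sqrt_eq_rpow, Real.sq_sqrt h]

lemma expect_abs_pos {p : ℝ} (hp0 : 0 < p) (hp1 : p < 1) {n : ℕ} {g : Cube n → ℝ} (hg : g ≠ 0) :
    0 < expect p fun x => |g x| := by
  obtain ⟨x, hx⟩ := Function.ne_iff.1 hg
  exact Finset.sum_pos' (fun y _ => mul_nonneg (abs_nonneg _) (mass_pos hp0 hp1 y).le)
    ⟨x, Finset.mem_univ x, mul_pos (abs_pos.2 hx) (mass_pos hp0 hp1 x)⟩

/-- Subpolynomial growth of `V` rules out the bound that small `L^1`-influences would give. -/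
lemma eventually_rpow_lt {V : ℕ → ℝ} (hV : ∀ n : ℕ, 1 ≤ n → 0 < V n)
    (hsub : ∀ ε : ℝ, 0 < ε → V =o[atTop] (fun n : ℕ => (n : ℝ) ^ ε))
    {t D c M : ℝ} (ht : 0 < t) (hc : 0 < c) (hM : 0 < M) (h : D * (c * M) < t) :
    ∀ᶠ n : ℕ in atTop,
      n * ((c * (V n * (Real.log n / n))) ^ (2 * t) *
        (M * (c * (V n * (Real.log n / n)))) ^ (1 - t)) <
      V n * Real.exp (-D * (n * (M * (c * (V n * (Real.log n / n)))) / V n)) := by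
  -- Divided by `V n^{-t}`, the claim says that a constant times `V^t (ln n)^{1 + t}` is below
  -- `n^η`. Half of the exponent `η` absorbs the power of the logarithm, the other half absorbs
  -- `V^t`.
  set η := t - D * (c * M) with hη
  have hη0 : 0 < η := sub_pos.2 h
  have hlog : (fun n : ℕ => Real.log n ^ (1 + t)) =o[atTop] fun n : ℕ => (n : ℝ) ^ (η / 2) :=
    (isLittleO_log_rpow_rpow_atTop (1 + t) (by positivity)).comp_tendsto tendsto_natCast_atTop_atTop
  have hVt : (fun n : ℕ => V n ^ t) =O[atTop] fun n : ℕ => (n : ℝ) ^ (η / 2) := by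
    have h1 := (hsub (η / 2 / t) (by positivity)).bound one_pos
    refine IsBigO.of_bound 1 ?_
    filter_upwards [h1, eventually_ge_atTop 1] with n hn hn1
    have hn0 : (0 : ℝ) < n := by exact_mod_cast hn1
    have hVn := hV n hn1
    rw [one_mul, Real.norm_of_nonneg (by positivity), Real.norm_of_nonneg (by positivity)] at hn ⊢
    calc V n ^ t ≤ ((n : ℝ) ^ (η / 2 / t)) ^ t := Real.rpow_le_rpow hVn.le hn ht.le
      _ = _ := by rw [← Real.rpow_mul hn0.le, div_mul_cancel₀ _ ht.ne']
  have hK : 0 < M ^ (1 - t) * c ^ (1 + t) := by positivity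
  have hprod := (hVt.mul_isLittleO hlog).bound (show 0 < (M ^ (1 - t) * c ^ (1 + t))⁻¹ / 2 by
    positivity)
  filter_upwards [hprod, eventually_ge_atTop 2] with n hn hn2
  have hn0 : (0 : ℝ) < n := by exact_mod_cast (show 0 < n by omega)
  have hn1 : (1 : ℝ) < n := by exact_mod_cast (show 1 < n by omega)
  have hVn := hV n (by omega)
  have hL : 0 < Real.log n := Real.log_pos hn1
  rw [← Real.rpow_add hn0, add_halves, Real.norm_of_nonneg (by positivity),
    Real.norm_of_nonneg (by positivity)] at hn
  have e1 : Real.exp (-D * (n * (M * (c * (V n * (Real.log n / n)))) / V n)) =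
      (n : ℝ) ^ (η - t) := by
    rw [Real.rpow_def_of_pos hn0, hη]
    congr 1
    field_simp
    ring
  have e2 : n * ((c * (V n * (Real.log n / n))) ^ (2 * t) *
        (M * (c * (V n * (Real.log n / n)))) ^ (1 - t)) =
      V n * ((M ^ (1 - t) * c ^ (1 + t)) * (V n ^ t * Real.log n ^ (1 + t)) * (n : ℝ) ^ (-t)) := by
    set δ := c * (V n * (Real.log n / n)) with hδ
    have hδ0 : 0 < δ := by positivity
    have hδe : δ ^ (1 + t) = c ^ (1 + t) * (V n * V n ^ t * (Real.log n ^ (1 + t) /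
        (n * (n : ℝ) ^ t))) := by
      rw [hδ, Real.mul_rpow hc.le (by positivity), Real.mul_rpow hVn.le (by positivity),
        Real.div_rpow hL.le hn0.le, Real.rpow_add hVn 1 t, Real.rpow_add hn0 1 t, Real.rpow_one,
        Real.rpow_one]
    rw [Real.mul_rpow hM.le hδ0.le, show δ ^ (2 * t) * (M ^ (1 - t) * δ ^ (1 - t)) =
      M ^ (1 - t) * (δ ^ (2 * t) * δ ^ (1 - t)) by ring, ← Real.rpow_add hδ0,
      show 2 * t + (1 - t) = 1 + t by ring, hδe, Real.rpow_neg hn0.le]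
    have := Real.rpow_pos_of_pos hn0 t
    field_simp
  rw [e1, e2, sub_eq_add_neg η, Real.rpow_add hn0]
  have hX := Real.rpow_pos_of_pos hn0 η
  gcongr
  calc _ ≤ M ^ (1 - t) * c ^ (1 + t) * ((M ^ (1 - t) * c ^ (1 + t))⁻¹ / 2 * (n : ℝ) ^ η) := by
        gcongr
    _ = (n : ℝ) ^ η / 2 := by field_simp
    _ < _ := half_lt_self hX

lemma tanh_half_eq (α : ℝ) :
    (2 - (1 + Real.exp (-α))) / (1 + Real.exp (-α)) = Real.tanh (α / 2) := by
  have h : Real.exp (-α) = Real.exp (-(α / 2)) * Real.exp (-(α / 2)) := by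
    rw [← Real.exp_add]; congr 1; ring
  have h2 : Real.exp (α / 2) * Real.exp (-(α / 2)) = 1 := by rw [← Real.exp_add]; simp
  have h3 := Real.exp_pos (α / 2)
  have h4 := Real.exp_pos (-(α / 2))
  rw [Real.tanh_eq_sinh_div_cosh, Real.sinh_eq, Real.cosh_eq, h, div_div_div_cancel_right₀ two_ne_zero,
    div_eq_div_iff (by positivity) (by positivity)]
  linear_combination (-2 * Real.exp (-(α / 2))) * h2

/-- If the bound failed, there would be reals `c` above the liminf and `M` above `M₀` with `D c M <
t`. Then infinitely many `n` satisfy the hypotheses of `variance_mul_exp_le_of_influence_le` with `δ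
= c V ln n / n`, against `eventually_rpow_lt`. -/
lemma div_constM_le_liminf {p : ℝ} (hp0 : 0 < p) (hp1 : p < 1) {f : (n : ℕ) → Cube n → ℝ}
    (hpos : ∀ n : ℕ, 1 ≤ n → 0 < variance p (f n))
    (hsub : ∀ ε : ℝ, 0 < ε →
      (fun n : ℕ => variance p (f n)) =o[atTop] (fun n : ℕ => (n : ℝ) ^ ε))
    {s D : ℝ} (hs1 : 1 < s) (hs2 : s < 2) (hD : 0 < D) (hR : Real.exp (-D) ≤ optimalRate p s) :
    ENNReal.ofReal ((2 - s) / s / D) / constM p f ≤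
      liminf (fun n : ℕ => ENNReal.ofReal
        ((⨆ i : Fin n, lqNorm p 1 (coordDiff p i (f n))) /
          (variance p (f n) * (Real.log n / n)))) atTop := by
  have hs0 : 0 < s := by linarith
  have ht : 0 < (2 - s) / s := div_pos (by linarith) hs0
  set t := (2 - s) / s with htdef
  by_contra! hlt
  obtain ⟨c, hc1, hc2⟩ := ENNReal.lt_iff_exists_nnreal_btwn.1 hlt
  have hc0 : 0 < c := by exact_mod_cast zero_le.trans_lt hc1
  have hMlt : constM p f < ENNReal.ofReal (t / D) / c := by
    rw [ENNReal.lt_div_iff_mul_lt (Or.inl (by exact_mod_cast hc0.ne')) (Or.inl ENNReal.coe_ne_top),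
      mul_comm]
    exact ENNReal.mul_lt_of_lt_div hc2
  obtain ⟨M, hM1, hM2⟩ := ENNReal.lt_iff_exists_nnreal_btwn.1 hMlt
  have hM0 : 0 < M := by exact_mod_cast zero_le.trans_lt hM1
  have hcM : D * ((c : ℝ) * M) < t := by
    have h := ENNReal.mul_lt_of_lt_div hM2
    rw [← ENNReal.coe_mul, ← ENNReal.ofReal_coe_nnreal,
      ENNReal.ofReal_lt_ofReal_iff (by positivity), lt_div_iff₀ hD] at h
    push_cast at h
    linarith
  have hev := eventually_rpow_lt hpos hsub ht (NNReal.coe_pos.2 hc0) (NNReal.coe_pos.2 hM0) hcM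
  have hMev := eventually_lt_of_limsup_lt hM1
  have hfreq := frequently_lt_of_liminf_lt (by isBoundedDefault) hc1
  obtain ⟨n, hn1, hn2, hn3, hn4⟩ := (hfreq.and_eventually
    (hMev.and (hev.and (eventually_ge_atTop 2)))).exists
  have hn : (1 : ℝ) < n := by exact_mod_cast (show 1 < n by omega)
  have hV := hpos n (by omega)
  have hL : 0 < Real.log n := Real.log_pos hn
  have hden : 0 < variance p (f n) * (Real.log n / n) := by positivity
  rw [← ENNReal.ofReal_coe_nnreal, ENNReal.ofReal_lt_ofReal_iff (NNReal.coe_pos.2 hc0),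
    div_lt_iff₀ hden] at hn1
  refine hn3.not_ge (variance_mul_exp_le_of_influence_le hp0 hp1 hs1 hs2 hD.le hR M.coe_nonneg
    (by positivity) (f n) hV (fun i => ?_) fun i => ?_)
  · rw [← lqNorm_one]
    exact (le_ciSup (Set.finite_range fun i => lqNorm p 1 (coordDiff p i (f n))).bddAbove i).trans
      hn1.le
  -- Coordinates with `f^{(i)} = 0` do not enter `M₀`; for them both sides vanish.
  · by_cases hg : coordDiff p i (f n) = 0
    · simp [hg, expect]
    · have h1 := (le_iSup₂ (f := fun (i : Fin n) (_ : coordDiff p i (f n) ≠ 0) => ENNReal.ofReal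
        (lqNorm p 2 (coordDiff p i (f n)) ^ 2 / lqNorm p 1 (coordDiff p i (f n)))) i hg).trans_lt hn2
      rw [← ENNReal.ofReal_coe_nnreal, ENNReal.ofReal_lt_ofReal_iff (NNReal.coe_pos.2 hM0),
        lqNorm_two_sq hp0 hp1, lqNorm_one, div_lt_iff₀ (expect_abs_pos hp0 hp1 hg)] at h1
      exact h1.le

end BiasedCube

theorem theorem1 (p : ℝ) (hp0 : 0 < p) (hp1 : p < 1)
    (f : (n : ℕ) → BiasedCube.Cube n → ℝ)
    (hpos : ∀ n : ℕ, 1 ≤ n → 0 < BiasedCube.variance p (f n))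
    (hsub : ∀ ε : ℝ, 0 < ε →
      (fun n : ℕ => BiasedCube.variance p (f n)) =o[atTop] (fun n : ℕ => (n : ℝ) ^ ε))
    (ρ : ℝ → ℝ)
    (hρ : ρ = BiasedCube.rhoPower p ∨ ρ = BiasedCube.rhoSinh p ∨ ρ = BiasedCube.rhoConst p) :
    BiasedCube.constC ρ / BiasedCube.constM p f ≤
      liminf
        (fun n : ℕ =>
          ENNReal.ofReal
            ((⨆ i : Fin n, BiasedCube.lqNorm p 1 (BiasedCube.coordDiff p i (f n))) /
              (BiasedCube.variance p (f n) * (Real.log n / n))))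
        atTop := by
  unfold BiasedCube.constC
  simp_rw [ENNReal.iSup_div]
  refine iSup₂_le fun α hα => ?_
  obtain ⟨hρ0, hle⟩ := BiasedCube.smoothing_sq_le_optimalRate hp0 hp1 hρ hα
  set D := α - Real.log (ρ (Real.exp α + 1) ^ 2) with hD
  have he : Real.exp (-D) = ρ (Real.exp α + 1) ^ 2 * Real.exp (-α) := by
    rw [hD, neg_sub, sub_eq_add_neg, Real.exp_add, Real.exp_log hρ0]
  -- For `D ≤ 0` the term of the supremum is truncated to `0` by `ENNReal.ofReal`, so positivity of
  -- `D` need not be proved.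
  rcases le_or_gt D 0 with hD0 | hD0
  · have ht : 0 ≤ Real.tanh (α / 2) := by
      rw [Real.tanh_eq_sinh_div_cosh]
      exact div_nonneg (Real.sinh_nonneg_iff.2 (by positivity)) (Real.cosh_pos _).le
    rw [ENNReal.ofReal_of_nonpos (div_nonpos_of_nonneg_of_nonpos ht hD0), ENNReal.zero_div]
    exact zero_le
  · have h1 : Real.exp (-α) < 1 := Real.exp_lt_one_iff.2 (by linarith)
    have h0 := Real.exp_pos (-α)
    have := BiasedCube.div_constM_le_liminf hp0 hp1 hpos hsub (s := 1 + Real.exp (-α))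
      (by linarith) (by linarith) hD0 (he.trans_le hle)
    rwa [BiasedCube.tanh_half_eq] at this
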